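/- Let $k$ be a field (for instance $\mathbb R$ or $\mathbb C$). An aromatic forest is an isomorphism class of finite directed graphs (self-loops and the empty graph $\mathbf 1$ are allowed) in which every node has at most one outgoing edge; a root is a node without outgoing edge, and an aromatic tree is an aromatic forest with exactly one root. Let $\mathcal{AF}$ and $\mathcal{AT}\subset\mathcal{AF}$ be the sets of aromatic forests and of aromatic trees, let $\bullet\in\mathcal{AT}$ be the graph with one node and no edge, and let $C_{\mathcal{AF}}^*=k^{\mathcal{AF}}$ and $C_{\mathcal{AT}}^*=k^{\mathcal{AT}}$ be the duals of the free vector spaces on these sets; $C_{\mathcal{AT}}^*\subset C_{\mathcal{AF}}^*$ by extension by $0$. Let $\epsilon,\bullet^*$ be the dual basis elements of $\mathbf 1$ and $\bullet$. For $a_1,a_2\in C_{\mathcal{AF}}^*$ the composition product is $(a_1\cdot a_2)(\phi)=\sum_p a_1(P^*(p))\,a_2(R(p))$, the sum being over all splittings $p$ of the vertex set of $\phi$ into two (possibly empty) parts, with induced subgraphs $P^*(p)$ and $R(p)$, such that no edge of $\phi$ goes from $R(p)$ to $P^*(p)$. With this product $C_{\mathcal{AF}}^*$ is an associative algebra with unit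 $\epsilon$, in which $a$ is invertible if and only if $a(\mathbf 1)\ne0$. A partition $p$ of $\phi$ is a partition of the vertices of $\phi$ into classes together with a set of kept edges, each of which joins two vertices of the same class, such that each class with its kept edges is an aromatic tree; $P(p)$ is the multiset of these aromatic trees. The skeleton $\chi(p)\in\mathcal{AF}$ has the classes as nodes and the remaining (cut) edges of $\phi$ as edges between the classes. The trivial partition of an aromatic tree has one class and keeps all edges. For $b\in C_{\mathcal{AT}}^*$ and $a\in C_{\mathcal{AF}}^*$ let $$(b\star a)(\phi)=\sum_{p} a(\chi(p))\prod_{\theta\in P(p)}b(\theta),$$ the sum being over all partitions $p$ of $\phi$. (a) If $a\in C_{\mathcal{AT}}^*$ then $b\star a\in C_{\mathcal{AT}}^*$, and $(C_{\mathcal{AT}}^*,\star)$ is a monoid with identity $\bullet^*$. It acts on $C_{\mathcal{AF}}^*$ by unital algebra morphisms: for all $a,a_1,a_2\in C_{\mathcal{AF}}^*$, $b,c\in C_{\mathcal{AT}}^*$, $\alpha_1,\alpha_2\in k$, $$b\star(\alpha_1a_1+\alpha_2a_2)=\alpha_1\,b\star a_1+\alpha_2\,b\star a_2,\qquad c\star(b\star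 a)=(c\star b)\star a,\qquad b\star\bullet^*=b,\qquad \bullet^*\star a=a,$$ $$b\star(a_1\cdot a_2)=(b\star a_1)\cdot(b\star a_2),\qquad b\star\epsilon=\epsilon,\qquad b\star a^{-1}=(b\star a)^{-1}\ \text{ if } a \text{ is invertible for the product }\cdot.$$ (b) The set $\{b\in C_{\mathcal{AT}}^*: b(\bullet)\neq0\}$ is a group under $\star$. The inverse $b^{\star-1}$ of $b$ is the unique element of $C_{\mathcal{AT}}^*$ with $$b^{\star-1}(\bullet)=\frac1{b(\bullet)},\qquad b^{\star-1}(\tau)=-\frac1{b(\bullet)}\sum_{p\ \text{nontrivial}} b(\chi(p))\prod_{\theta\in P(p)}b^{\star-1}(\theta)\quad(\tau\in\mathcal{AT},\ \tau\neq\bullet),$$ the sum being over all partitions $p$ of $\tau$ other than the trivial one. -/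

import Mathlib

noncomputable section

namespace Aromatic

/-- A finite directed graph (self-loops allowed, possibly without vertices) in which every node has
at most one outgoing edge. `graph.Adj u v` says that there is an edge going out of `u` into `v`. -/
structure Graph : Type 1 where
  V : Type
  finite : Finite V
  graph : Digraph V
  out_unique : ∀ u v w, graph.Adj u v → graph.Adj u w → v = w

attribute [instance] Graph.finite

namespace Graph

/-- A root is a node without outgoing edges. -/
def IsRoot (G : Graph) (u : G.V) : Prop := ∀ w, ¬ G.graph.Adj u w

/-- The graph has exactly one root. -/
def HasOneRoot (G : Graph) : Prop := ∃! r, G.IsRoot r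

/-- Equivalence of directed graphs: a bijection of the vertices that carries one edge set onto the
other. -/
def Iso (G H : Graph) : Prop := Nonempty (G.graph.Adj ≃r H.graph.Adj)

theorem Iso.refl (G : Graph) : Iso G G := ⟨RelIso.refl _⟩

theorem Iso.symm {G H : Graph} : Iso G H → Iso H G := fun ⟨e⟩ => ⟨RelIso.symm e⟩

theorem Iso.trans {G H K : Graph} : Iso G H → Iso H K → Iso G K :=
  fun ⟨e⟩ ⟨f⟩ => ⟨e.trans f⟩

instance isoSetoid : Setoid Graph := ⟨Iso, Iso.refl, Iso.symm, Iso.trans⟩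

/-- The subgraph with vertex set `W` whose edges are the edges of `F` between vertices of `W`. -/
def sub (G : Graph) (W : Set G.V) (F : Digraph G.V) (hF : F ≤ G.graph) : Graph where
  V := W
  finite := inferInstance
  graph := ⟨fun u v => F.Adj u.1 v.1⟩
  out_unique := fun u v w h1 h2 => Subtype.ext (G.out_unique u.1 v.1 w.1 (hF h1) (hF h2))

/-- The subgraph with vertex set `W` and all edges of `G` between vertices of `W`. -/
def induce (G : Graph) (W : Set G.V) : Graph := G.sub W G.graph le_rfl

/-- An admissible partition of the graph `G` into two (possibly empty) subgraphs `R` and `P*`,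
with no edge from `R` to `P*`. It is given by the vertex set of `R`; the vertex set of `P*` is the
complement. -/
@[ext]
structure AdmissiblePartition (G : Graph) where
  R : Set G.V
  no_edge : ∀ u ∈ R, ∀ v ∉ R, ¬ G.graph.Adj u v

instance (G : Graph) : Finite G.AdmissiblePartition :=
  Finite.of_injective (fun p => p.R) fun _ _ h => AdmissiblePartition.ext h

instance (G : Graph) : Fintype G.AdmissiblePartition := Fintype.ofFinite _

/-- The subgraph `R(p)`. -/
def AdmissiblePartition.lower {G : Graph} (p : G.AdmissiblePartition) : Graph := G.induce p.R

/-- The subgraph `P*(p)`. -/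
def AdmissiblePartition.upper {G : Graph} (p : G.AdmissiblePartition) : Graph := G.induce p.Rᶜ

/-- A partition of the graph `G` into subgraphs with exactly one root each. It is given by a
partition of the vertices into classes together with the set of the edges that are kept (not cut);
every kept edge stays within a class, and each class with its kept edges has exactly one root.
Edges inside a class may be cut as well. -/
@[ext]
structure Partition (G : Graph) where
  classes : Setoid G.V
  kept : Digraph G.V
  kept_le : kept ≤ G.graph
  kept_classes : ∀ u v, kept.Adj u v → classes u v
  oneRoot : ∀ B : Quotient classes, (G.sub {v | Quotient.mk classes v = B} kept kept_le).HasOneRoot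

namespace Partition

variable {G : Graph}

instance : Finite G.Partition := by
  have : Finite (Setoid G.V) :=
    Finite.of_injective (fun s : Setoid G.V => (fun u v => s u v : G.V → G.V → Prop))
      fun _ _ h => Setoid.ext fun u v => iff_of_eq (congrFun (congrFun h u) v)
  have : Finite (Digraph G.V) :=
    Finite.of_injective (fun s : Digraph G.V => s.Adj) fun _ _ h => Digraph.ext h
  exact Finite.of_injective (fun p : G.Partition => (p.classes, p.kept)) fun p q h =>
    Partition.ext (congrArg Prod.fst h) (congrArg Prod.snd h)

instance : Fintype G.Partition := Fintype.ofFinite _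

/-- The index type of the subgraphs of the partition. -/
def Index (p : G.Partition) : Type := Quotient p.classes

instance (p : G.Partition) : Finite p.Index := inferInstanceAs (Finite (Quotient p.classes))

instance (p : G.Partition) : Fintype p.Index := Fintype.ofFinite _

/-- The subgraph a vertex belongs to. -/
def toIndex (p : G.Partition) (v : G.V) : p.Index := Quotient.mk p.classes v

/-- The subgraph of the partition with index `B`. -/
def part (p : G.Partition) (B : p.Index) : Graph := G.sub {v | p.toIndex v = B} p.kept p.kept_le

theorem part_hasOneRoot (p : G.Partition) (B : p.Index) : (p.part B).HasOneRoot := p.oneRoot B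

theorem eq_of_cut (p : G.Partition) {u v u' v' : G.V} (h : p.toIndex u = p.toIndex u')
    (h1 : G.graph.Adj u v) (h1' : ¬ p.kept.Adj u v)
    (h2 : G.graph.Adj u' v') (h2' : ¬ p.kept.Adj u' v') : u = u' := by
  have key : ∀ (x y : G.V) (_ : G.graph.Adj x y) (_ : ¬ p.kept.Adj x y) (hx : p.toIndex x = p.toIndex u'),
      (p.part (p.toIndex u')).IsRoot ⟨x, hx⟩ := by
    intro x y h h' hx w hw
    have hw' : p.kept.Adj x w.1 := hw
    have := G.out_unique x y w.1 h (p.kept_le hw')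
    exact h' (this ▸ hw')
  exact congrArg Subtype.val
    ((p.part_hasOneRoot (p.toIndex u')).unique (key u v h1 h1' h) (key u' v' h2 h2' rfl))

/-- The skeleton: each subgraph of the partition is collapsed to a single node, and the cut edges
remain as edges between these nodes. -/
def skeleton (p : G.Partition) : Graph where
  V := p.Index
  finite := inferInstance
  graph := ⟨fun B C => ∃ u v, p.toIndex u = B ∧ p.toIndex v = C ∧
    G.graph.Adj u v ∧ ¬ p.kept.Adj u v⟩
  out_unique := by
    rintro _ _ _ ⟨u, v, rfl, rfl, h1, h1'⟩ ⟨u', v', h, rfl, h2, h2'⟩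
    obtain rfl := p.eq_of_cut h.symm h1 h1' h2 h2'
    rw [G.out_unique _ _ _ h1 h2]

/-- The trivial partition: one subgraph, the whole graph. -/
def IsTrivial (p : G.Partition) : Prop := p.classes = ⊤ ∧ p.kept = G.graph

instance : Fintype {p : G.Partition // ¬ p.IsTrivial} := Fintype.ofFinite _

end Partition

end Graph

/-- Aromatic forests: equivalence classes of finite directed graphs in which each node has at most
one outgoing edge. -/
def AF : Type 1 := Quotient Graph.isoSetoid

/-- The aromatic forest represented by a graph. -/
def Graph.toAF (G : Graph) : AF := Quotient.mk Graph.isoSetoid G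

theorem Graph.toAF_eq {G H : Graph} (e : G.graph.Adj ≃r H.graph.Adj) : G.toAF = H.toAF :=
  Quotient.sound (s := Graph.isoSetoid) ⟨e⟩

theorem Graph.Iso.hasOneRoot {G H : Graph} (h : G.Iso H) (hG : G.HasOneRoot) : H.HasOneRoot := by
  obtain ⟨e⟩ := h
  obtain ⟨r, hr, hu⟩ := hG
  refine ⟨e r, fun w hw => hr (e.symm w) ?_, fun y hy => ?_⟩
  · have := e.symm.map_rel_iff.2 hw
    simpa using this
  · have : e.symm y = r := hu _ fun w hw => hy (e w) (by simpa using e.map_rel_iff.2 hw)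
    rw [← this]; simp

/-- The aromatic forest has exactly one root. -/
def AF.HasOneRoot (φ : AF) : Prop :=
  Quotient.lift Graph.HasOneRoot
    (fun _ _ h => propext ⟨Graph.Iso.hasOneRoot h, Graph.Iso.hasOneRoot (Graph.Iso.symm h)⟩) φ

/-- Aromatic trees: aromatic forests with exactly one root. -/
def AT : Type 1 := {φ : AF // φ.HasOneRoot}

/-- The aromatic tree represented by a graph with exactly one root. -/
def Graph.toAT (G : Graph) (h : G.HasOneRoot) : AT := ⟨G.toAF, h⟩

theorem Graph.toAT_eq {G H : Graph} (e : G.graph.Adj ≃r H.graph.Adj) (hG : G.HasOneRoot)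
    (hH : H.HasOneRoot) : G.toAT hG = H.toAT hH :=
  Subtype.ext (Graph.toAF_eq e)

/-- The empty graph. -/
def Graph.empty : Graph := ⟨Empty, inferInstance, ⊥, fun u => u.elim⟩

/-- The graph with a single node and no edge. -/
def Graph.bullet : Graph := ⟨Unit, inferInstance, ⊥, fun _ _ _ _ _ => rfl⟩

theorem Graph.bullet_hasOneRoot : Graph.bullet.HasOneRoot :=
  ⟨(), fun _ h => h, fun _ _ => rfl⟩

/-- The empty aromatic forest. -/
def AF.empty : AF := Graph.empty.toAF

/-- The aromatic tree with a single node and no edge. -/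
def AT.bullet : AT := Graph.bullet.toAT Graph.bullet_hasOneRoot

/-- The dual of the free vector space over the aromatic forests: series indexed by `AF`. -/
abbrev DualAF (k : Type*) : Type _ := AF → k

/-- The dual of the free vector space over the aromatic trees: series indexed by `AT`. -/
abbrev DualAT (k : Type*) : Type _ := AT → k

variable {k : Type*} [Field k]

open Classical in
/-- A series indexed by aromatic trees as a series indexed by aromatic forests, with the value `0`
on the forests that are not aromatic trees. -/
def DualAT.toAF (b : DualAT k) : DualAF k := fun φ => if h : φ.HasOneRoot then b ⟨φ, h⟩ else 0

open Classical in
/-- The dual basis element of the tree with a single node. -/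
def bulletDual (k : Type*) [Field k] : DualAT k := fun τ => if τ = AT.bullet then 1 else 0

open Classical in
/-- The counit, which is the unit of the composition product. -/
def counit (k : Type*) [Field k] : DualAF k := fun φ => if φ = AF.empty then 1 else 0

/-- The coefficient of the composition product at a graph. -/
def compGraph (a₁ a₂ : DualAF k) (G : Graph) : k :=
  ∑ p : G.AdmissiblePartition, a₁ p.upper.toAF * a₂ p.lower.toAF

/-- The coefficient of the substitution product at a graph. -/
def substGraph (b : DualAT k) (a : DualAF k) (G : Graph) : k :=
  ∑ p : G.Partition, a p.skeleton.toAF * ∏ B : p.Index, b ((p.part B).toAT (p.part_hasOneRoot B))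

/-- Transport of the subgraph construction along an isomorphism. -/
def subIso {G H : Graph} (e : G.V ≃ H.V) {W : Set G.V} {W' : Set H.V}
    {F : Digraph G.V} {F' : Digraph H.V} (hF : F ≤ G.graph) (hF' : F' ≤ H.graph)
    (hW : ∀ v, v ∈ W ↔ e v ∈ W') (hFF : ∀ u v, F'.Adj (e u) (e v) ↔ F.Adj u v) :
    (G.sub W F hF).graph.Adj ≃r (H.sub W' F' hF').graph.Adj where
  toEquiv := e.subtypeEquiv hW
  map_rel_iff' := fun {u v} => hFF u.1 v.1

/-- Transport of admissible partitions along an isomorphism. -/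
def mapAdm {G H : Graph} (e : G.graph.Adj ≃r H.graph.Adj) (p : G.AdmissiblePartition) :
    H.AdmissiblePartition where
  R := {v | e.symm v ∈ p.R}
  no_edge := fun _ hu _ hv h => p.no_edge _ hu _ hv (e.symm.map_rel_iff.2 h)

theorem compGraph_congr (a₁ a₂ : DualAF k) {G H : Graph} (h : G.Iso H) :
    compGraph a₁ a₂ G = compGraph a₁ a₂ H := by
  obtain ⟨e⟩ := h
  refine Fintype.sum_equiv ⟨mapAdm e, mapAdm e.symm, fun p => ?_, fun p => ?_⟩ _ _ fun p => ?_
  · ext v; simp [mapAdm]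
  · ext v; simp [mapAdm]
  · congr 2
    · exact Graph.toAF_eq (subIso e.toEquiv le_rfl le_rfl (by simp [mapAdm]) fun _ _ => e.map_rel_iff)
    · exact Graph.toAF_eq (subIso e.toEquiv le_rfl le_rfl (by simp [mapAdm]) fun _ _ => e.map_rel_iff)

/-- Transport of partitions along an isomorphism. -/
def mapPartition {G H : Graph} (e : G.graph.Adj ≃r H.graph.Adj) (p : G.Partition) :
    H.Partition where
  classes := p.classes.comap e.symm
  kept := ⟨fun u v => p.kept.Adj (e.symm u) (e.symm v)⟩
  kept_le := fun _ _ h => e.symm.map_rel_iff.1 (p.kept_le h)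
  kept_classes := fun _ _ h => p.kept_classes _ _ h
  oneRoot := by
    intro B
    obtain ⟨w, rfl⟩ := Quotient.exists_rep B
    refine Graph.Iso.hasOneRoot ⟨?_⟩ (p.oneRoot (Quotient.mk p.classes (e.symm w)))
    refine subIso e.toEquiv _ _ (fun v => ?_) fun u v => by simp
    change Quotient.mk p.classes v = Quotient.mk p.classes (e.symm w) ↔
      Quotient.mk (p.classes.comap e.symm) (e v) = Quotient.mk (p.classes.comap e.symm) w
    rw [Quotient.eq, Quotient.eq]
    change _ ↔ p.classes (e.symm (e v)) (e.symm w)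
    simp

/-- The bijection between the index types of a partition and of its transport. -/
def indexEquiv {G H : Graph} (e : G.graph.Adj ≃r H.graph.Adj) (p : G.Partition) :
    p.Index ≃ (mapPartition e p).Index :=
  Quotient.congr (ra := p.classes) (rb := (mapPartition e p).classes) e.toEquiv fun u v => by
    change p.classes u v ↔ p.classes (e.symm (e u)) (e.symm (e v))
    simp

theorem indexEquiv_toIndex {G H : Graph} (e : G.graph.Adj ≃r H.graph.Adj) (p : G.Partition)
    (v : G.V) : indexEquiv e p (p.toIndex v) = (mapPartition e p).toIndex (e v) := rfl

theorem substGraph_congr (b : DualAT k) (a : DualAF k) {G H : Graph} (h : G.Iso H) :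
    substGraph b a G = substGraph b a H := by
  obtain ⟨e⟩ := h
  refine Fintype.sum_equiv ⟨mapPartition e, mapPartition e.symm, fun p => ?_, fun p => ?_⟩ _ _
    fun p => ?_
  · refine Graph.Partition.ext (Setoid.ext fun u v => ?_) (Digraph.ext ?_)
    · change p.classes (e.symm (e u)) (e.symm (e v)) ↔ _
      simp
    · funext u v; simp [mapPartition]
  · refine Graph.Partition.ext (Setoid.ext fun u v => ?_) (Digraph.ext ?_)
    · change p.classes (e (e.symm u)) (e (e.symm v)) ↔ _
      simp
    · funext u v; simp [mapPartition]
  · refine congrArg₂ _ (congrArg a (Graph.toAF_eq ⟨indexEquiv e p, fun {B C} => ?_⟩)) ?_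
    · constructor
      · rintro ⟨u, v, hu, hv, h1, h2⟩
        refine ⟨e.symm u, e.symm v, ?_, ?_, e.symm.map_rel_iff.2 h1, h2⟩
        · apply (indexEquiv e p).injective
          refine Eq.trans ?_ hu
          rw [indexEquiv_toIndex, RelIso.apply_symm_apply]; rfl
        · apply (indexEquiv e p).injective
          refine Eq.trans ?_ hv
          rw [indexEquiv_toIndex, RelIso.apply_symm_apply]; rfl
      · rintro ⟨u, v, rfl, rfl, h1, h2⟩
        exact ⟨e u, e v, rfl, rfl, e.map_rel_iff.2 h1, by simpa [mapPartition] using h2⟩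
    · refine Fintype.prod_equiv (indexEquiv e p) _ _ fun B => congrArg b ?_
      refine Graph.toAT_eq (subIso e.toEquiv _ _ (fun v => ?_) fun u v => ?_) _ _
      · change p.toIndex v = B ↔ (mapPartition e p).toIndex (e v) = indexEquiv e p B
        rw [← indexEquiv_toIndex, (indexEquiv e p).apply_eq_iff_eq]
      · simp [mapPartition]

/-- The composition product of two series indexed by aromatic forests: the product dual to the
coproduct `φ ↦ ∑ P*(p) ⊗ R(p)`, the sum being over the admissible partitions `p` of `φ`. -/
def comp (a₁ a₂ : DualAF k) : DualAF k :=
  Quotient.lift (compGraph a₁ a₂) fun _ _ h => compGraph_congr a₁ a₂ h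

/-- The substitution product `b ⋆ a` of a series `b` indexed by aromatic trees and a series `a`
indexed by aromatic forests. -/
def subst (b : DualAT k) (a : DualAF k) : DualAF k :=
  Quotient.lift (substGraph b a) fun _ _ h => substGraph_congr b a h

/-- The substitution product `c ⋆ b` of two series indexed by aromatic trees, as a series indexed by
aromatic trees. -/
def substAT (c b : DualAT k) : DualAT k := fun τ => subst c b.toAF τ.1

/-- `a'` is the two-sided inverse of `a` for the composition product. -/
def IsCompInverse (a a' : DualAF k) : Prop := comp a a' = counit k ∧ comp a' a = counit k

/-- The recursive formula for the inverse `b'` of `b` under the substitution product. The sum is over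
all partitions other than the trivial one; the skeleton of a partition of an aromatic tree is again an
aromatic tree. -/
def IsRecursiveInverse (b b' : DualAT k) : Prop :=
  b' AT.bullet = 1 / b AT.bullet ∧
  ∀ (G : Graph) (hG : G.HasOneRoot), G.toAT hG ≠ AT.bullet →
    b' (G.toAT hG) = -(1 / b AT.bullet) * ∑ p : {p : G.Partition // ¬ p.IsTrivial},
      b.toAF p.1.skeleton.toAF * ∏ B : p.1.Index, b' ((p.1.part B).toAT (p.1.part_hasOneRoot B))

end Aromatic

end

open Aromatic

/-!
A partition into aromatic trees is determined by the map `ρ` that sends each vertex to the root of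
its class: since every vertex has at most one outgoing edge, the kept edges are exactly those that
leave the vertices not fixed by `ρ`. The partitions of the skeleton of `ρ` are then the coarsenings
of `ρ`, and the families of partitions of the classes of `σ` are the refinements of `σ`, so that
both `c ⋆ (b ⋆ a)` and `(c ⋆ b) ⋆ a` are sums over the pairs of partitions one of which refines the
other. Likewise `b ⋆ (a₁ · a₂)` and `(b ⋆ a₁) · (b ⋆ a₂)` are both sums over the pairs consisting of
a partition and an admissible splitting that separates none of its classes.

For the inverses, the maps `x ↦ a · x` and `x ↦ x ⋆ b` are triangular with respect to the number of
vertices, with constant diagonal entries `a 1` and `b •`. If these are nonzero, the maps are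
bijective: surjectivity gives one-sided inverses, and injectivity together with associativity shows
that they are two-sided.
-/

noncomputable section

namespace Aromatic

theorem bijective_of_triangular {X R : Type*} [Ring R] {r : X → X → Prop} (hr : WellFounded r)
    {c : X → R} (hc : ∀ x, IsUnit (c x)) {T : (X → R) → X → R}
    (hT : ∀ f g x, (∀ y, r y x → f y = g y) → T f x - T g x = c x * (f x - g x)) :
    Function.Bijective T := by
  classical
  refine ⟨fun f g h => funext fun x => ?_, fun t => ?_⟩
  · induction x using hr.induction with
    | _ x ih =>
      have hx := hT f g x ih
      rw [h, sub_self] at hx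
      exact sub_eq_zero.1 ((hc x).mul_right_eq_zero.1 hx.symm)
  · obtain ⟨f, hf⟩ : ∃ f : X → R, ∀ x,
        c x * f x = t x - T (fun y => if r y x then f y else 0) x := by
      refine ⟨hr.fix fun x f => ((hc x).unit⁻¹ : Rˣ) *
        (t x - T (fun y => if h : r y x then f y h else 0) x), fun x => ?_⟩
      rw [hr.fix_eq, ← mul_assoc, (hc x).mul_val_inv, one_mul]
      simp only [dite_eq_ite]
    refine ⟨f, funext fun x => ?_⟩
    have hx := hT f (fun y => if r y x then f y else 0) x fun y hy => (if_pos hy).symm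
    rw [if_neg (hr.irrefl.irrefl x), sub_zero, hf] at hx
    exact sub_left_inj.1 hx

theorem sum_eq_sum_filter_of_equiv {α β M : Type*} [Fintype α] [Fintype β] [AddCommMonoid M]
    {P : β → Prop} [DecidablePred P] (e : α ≃ {b // P b}) {f : α → M} {g : β → M}
    (h : ∀ a, f a = g (e a)) : ∑ a, f a = ∑ b with P b, g b := by
  rw [Finset.sum_subtype (p := P) _ (by simp) g]
  exact Fintype.sum_equiv e _ _ h

theorem sum_eq_add_sum_subtype_not {α M : Type*} [Fintype α] [AddCommMonoid M] {P : α → Prop}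
    [Fintype {a // ¬ P a}] (h : ∃! a, P a) {a₀ : α} (ha₀ : P a₀) (f : α → M) :
    ∑ a, f a = f a₀ + ∑ a : {a // ¬ P a}, f a := by
  classical
  have hP (a : α) : a ∈ Finset.univ.erase a₀ ↔ ¬ P a := by
    simpa using not_congr ⟨fun heq => heq ▸ ha₀, fun ha => h.unique ha ha₀⟩
  rw [← Finset.sum_subtype _ hP f, Finset.add_sum_erase _ _ (Finset.mem_univ a₀)]

theorem DualAF.ext_toAF {S : Type*} {a a' : DualAF S}
    (h : ∀ G : Graph, a G.toAF = a' G.toAF) : a = a' :=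
  funext (Quotient.ind h)

theorem AT.exists_toAT (τ : AT) : ∃ (G : Graph) (hG : G.HasOneRoot), G.toAT hG = τ := by
  obtain ⟨φ, hφ⟩ := τ
  obtain ⟨G, rfl⟩ := Quotient.exists_rep φ
  exact ⟨G, hφ, rfl⟩

theorem DualAT.ext_toAT {S : Type*} {b b' : DualAT S}
    (h : ∀ (G : Graph) (hG : G.HasOneRoot), b (G.toAT hG) = b' (G.toAT hG)) : b = b' :=
  funext fun τ => by
    obtain ⟨G, hG, rfl⟩ := τ.exists_toAT
    exact h G hG

variable {k : Type*} [Field k]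

theorem DualAT.toAF_toAF (b : DualAT k) {G : Graph} (hG : G.HasOneRoot) :
    b.toAF G.toAF = b (G.toAT hG) :=
  dif_pos hG

theorem DualAT.toAF_eq_zero (b : DualAT k) {G : Graph} (hG : ¬ G.HasOneRoot) :
    b.toAF G.toAF = 0 :=
  dif_neg hG

theorem DualAT.toAF_injective : Function.Injective (DualAT.toAF (k := k)) := fun b c h =>
  DualAT.ext_toAT fun G hG => by rw [← b.toAF_toAF hG, ← c.toAF_toAF hG, h]

/-! ### Partitions as root maps -/

namespace Graph

variable {G : Graph}

/-- A partition of a graph, encoded by the map that sends each vertex to the root of its class. The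
vertices which are not fixed by this map keep their outgoing edge, which has to end in the same
class; the edges going out of fixed vertices are cut. -/
@[ext]
structure RootMap (G : Graph) where
  root : G.V → G.V
  root_root : ∀ v, root (root v) = root v
  exists_adj : ∀ v, root v ≠ v → ∃ w, G.graph.Adj v w ∧ root w = root v

namespace RootMap

instance : Finite G.RootMap :=
  Finite.of_injective (fun ρ => ρ.root) fun _ _ h => RootMap.ext h

instance : Fintype G.RootMap := Fintype.ofFinite _

/-- The fixed vertices of a root map, which are the roots of the classes; they serve as indices of
the classes. -/
def Fix (ρ : G.RootMap) : Type := {v : G.V // ρ.root v = v}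

instance (ρ : G.RootMap) : Finite ρ.Fix := inferInstanceAs (Finite {v : G.V // ρ.root v = v})

instance (ρ : G.RootMap) : Fintype ρ.Fix := Fintype.ofFinite _

variable (ρ : G.RootMap) {u v : G.V}

/-- The root of the class of a vertex, as an index of this class. -/
def toFix (v : G.V) : ρ.Fix := ⟨ρ.root v, ρ.root_root v⟩

theorem toFix_coe (r : ρ.Fix) : ρ.toFix r.1 = r := Subtype.ext r.2

theorem toFix_eq_iff {r : ρ.Fix} : ρ.toFix v = r ↔ ρ.root v = r.1 := Subtype.ext_iff

theorem toFix_eq_of_adj (h : G.graph.Adj u v) (hu : ρ.root u ≠ u) : ρ.toFix v = ρ.toFix u := by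
  obtain ⟨w, hw, hroot⟩ := ρ.exists_adj u hu
  rw [G.out_unique _ _ _ h hw]
  exact Subtype.ext hroot

theorem root_eq_of_isRoot (h : G.IsRoot v) : ρ.root v = v := by
  by_contra hv
  obtain ⟨w, hw, -⟩ := ρ.exists_adj v hv
  exact h w hw

/-- The kept edges: those going out of a vertex which is not the root of its class. -/
def kept : Digraph G.V := ⟨fun u v => G.graph.Adj u v ∧ ρ.root u ≠ u⟩

theorem kept_le : ρ.kept ≤ G.graph := fun _ _ h => h.1

/-- The class with root `r`, with the kept edges. -/
def part (r : ρ.Fix) : Graph := G.sub {v | ρ.toFix v = r} ρ.kept ρ.kept_le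

theorem part_hasOneRoot (r : ρ.Fix) : (ρ.part r).HasOneRoot := by
  refine ⟨⟨r.1, ρ.toFix_coe r⟩, fun w hw => hw.2 r.2, fun ⟨v, hv⟩ hroot => Subtype.ext ?_⟩
  by_contra hne
  have hv' : ρ.root v ≠ v := fun h => hne (h.symm.trans (ρ.toFix_eq_iff.1 hv))
  obtain ⟨w, hw, hwv⟩ := ρ.exists_adj v hv'
  exact hroot ⟨w, (Subtype.ext hwv : ρ.toFix w = ρ.toFix v).trans hv⟩ ⟨hw, hv'⟩

/-- The skeleton of the partition encoded by a root map, with the roots of the classes as nodes. -/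
def skeleton : Graph where
  V := ρ.Fix
  finite := inferInstance
  graph := ⟨fun r s => ∃ w, G.graph.Adj r.1 w ∧ ρ.toFix w = s⟩
  out_unique := by
    rintro r _ _ ⟨w, h, rfl⟩ ⟨w', h', rfl⟩
    rw [G.out_unique _ _ _ h h']

theorem skeleton_isRoot_iff (r : ρ.Fix) : ρ.skeleton.IsRoot r ↔ G.IsRoot r.1 :=
  ⟨fun h w hw => h (ρ.toFix w) ⟨w, hw, rfl⟩, fun h _ ⟨w, hw, _⟩ => h w hw⟩

theorem skeleton_hasOneRoot_iff : ρ.skeleton.HasOneRoot ↔ G.HasOneRoot := by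
  constructor
  · rintro ⟨r, hr, hunique⟩
    refine ⟨r.1, (ρ.skeleton_isRoot_iff r).1 hr, fun v hv => ?_⟩
    exact congrArg Subtype.val
      (hunique ⟨v, ρ.root_eq_of_isRoot hv⟩ ((ρ.skeleton_isRoot_iff _).2 hv))
  · rintro ⟨v, hv, hunique⟩
    exact ⟨⟨v, ρ.root_eq_of_isRoot hv⟩, (ρ.skeleton_isRoot_iff _).2 hv,
      fun r hr => Subtype.ext (hunique r.1 ((ρ.skeleton_isRoot_iff r).1 hr))⟩

end RootMap

namespace Partition

variable (p : G.Partition) {u v : G.V}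

theorem toIndex_eq_iff : p.toIndex u = p.toIndex v ↔ p.classes u v := Quotient.eq

theorem toIndex_surjective : Function.Surjective p.toIndex := Quotient.exists_rep

/-- The root of the class with index `B`. -/
def classRoot (B : p.Index) : G.V := (p.part_hasOneRoot B).exists.choose.1

theorem toIndex_classRoot (B : p.Index) : p.toIndex (p.classRoot B) = B :=
  (p.part_hasOneRoot B).exists.choose.2

theorem classRoot_toIndex_eq_iff :
    p.classRoot (p.toIndex u) = v ↔ p.toIndex u = p.toIndex v ∧ ∀ w, ¬ p.kept.Adj v w := by
  have hpart := p.part_hasOneRoot (p.toIndex u)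
  constructor
  · rintro rfl
    refine ⟨(p.toIndex_classRoot _).symm, fun w hw => hpart.exists.choose_spec ⟨w, ?_⟩ hw⟩
    exact (p.toIndex_eq_iff.2 (p.kept_classes _ _ hw)).symm.trans (p.toIndex_classRoot _)
  · rintro ⟨huv, hv⟩
    exact congrArg Subtype.val (hpart.unique (y₂ := ⟨v, huv.symm⟩) hpart.exists.choose_spec
      fun w hw => hv w.1 hw)

theorem classRoot_toIndex_ne_iff : p.classRoot (p.toIndex v) ≠ v ↔ ∃ w, p.kept.Adj v w := by
  simp only [ne_eq, classRoot_toIndex_eq_iff, true_and, not_forall, not_not]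

/-- The map that sends each vertex to the root of its class. -/
def toRootMap : G.RootMap where
  root v := p.classRoot (p.toIndex v)
  root_root v := by rw [toIndex_classRoot]
  exists_adj v hv := by
    obtain ⟨w, hw⟩ := p.classRoot_toIndex_ne_iff.1 hv
    exact ⟨w, p.kept_le hw, by rw [p.toIndex_eq_iff.2 (p.kept_classes _ _ hw)]⟩

end Partition

namespace RootMap

variable (ρ : G.RootMap)

/-- The partition encoded by a root map. -/
def toPartition : G.Partition where
  classes := Setoid.ker ρ.toFix
  kept := ρ.kept
  kept_le := ρ.kept_le
  kept_classes _ _ h := (ρ.toFix_eq_of_adj h.1 h.2).symm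
  oneRoot B := by
    obtain ⟨w, rfl⟩ := Quotient.exists_rep B
    have hclass : {v | Quotient.mk (Setoid.ker ρ.toFix) v = Quotient.mk _ w} =
        {v | ρ.toFix v = ρ.toFix w} := Set.ext fun v => Quotient.eq
    rw [hclass]
    exact ρ.part_hasOneRoot _

/-- The correspondence between root maps and partitions. -/
def partitionEquiv : G.RootMap ≃ G.Partition where
  toFun := toPartition
  invFun := Partition.toRootMap
  left_inv ρ := RootMap.ext <| funext fun v => (Partition.classRoot_toIndex_eq_iff _).2
    ⟨(ρ.toPartition.toIndex_eq_iff.2 (ρ.toFix_coe (ρ.toFix v))).symm,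
      fun _ hw => hw.2 (ρ.root_root v)⟩
  right_inv p := by
    refine Partition.ext (Setoid.ext fun u v => ?_) (Digraph.ext ?_)
    · exact (toFix_eq_iff _).trans <|
        (Function.LeftInverse.injective p.toIndex_classRoot).eq_iff.trans p.toIndex_eq_iff
    · funext u v
      refine propext ⟨fun ⟨huv, hu⟩ => ?_,
        fun h => ⟨p.kept_le h, p.classRoot_toIndex_ne_iff.2 ⟨v, h⟩⟩⟩
      obtain ⟨w, hw⟩ := p.classRoot_toIndex_ne_iff.1 hu
      rwa [G.out_unique _ _ _ huv (p.kept_le hw)]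

/-- The correspondence between the two ways of indexing the classes of a partition. -/
def indexEquivFix : ρ.toPartition.Index ≃ ρ.Fix :=
  Setoid.quotientKerEquivOfRightInverse ρ.toFix Subtype.val ρ.toFix_coe

theorem toAF_skeleton_toPartition : ρ.toPartition.skeleton.toAF = ρ.skeleton.toAF := by
  refine Graph.toAF_eq ⟨ρ.indexEquivFix, fun {B C} => ?_⟩
  obtain ⟨u, rfl⟩ := ρ.toPartition.toIndex_surjective B
  obtain ⟨v, rfl⟩ := ρ.toPartition.toIndex_surjective C
  constructor
  · rintro ⟨w, hw, hwv⟩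
    exact ⟨ρ.root u, w, ρ.toPartition.toIndex_eq_iff.2 (ρ.toFix_coe (ρ.toFix u)),
      ρ.toPartition.toIndex_eq_iff.2 hwv, hw, fun h => h.2 (ρ.root_root u)⟩
  · rintro ⟨u', w, hu', hwv, hw, hcut⟩
    have hfix : ρ.root u' = u' := not_not.1 fun h => hcut ⟨hw, h⟩
    rw [← hu']
    refine ⟨w, ?_, ρ.toPartition.toIndex_eq_iff.1 hwv⟩
    change G.graph.Adj (ρ.root u') w
    rwa [hfix]

theorem toAF_part_toPartition (B : ρ.toPartition.Index) :
    (ρ.toPartition.part B).toAF = (ρ.part (ρ.indexEquivFix B)).toAF :=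
  Graph.toAF_eq <| subIso (Equiv.refl _) _ _
    (fun _ => (ρ.indexEquivFix.apply_eq_iff_eq (y := B)).symm) fun _ _ => Iff.rfl

end RootMap

end Graph

theorem comp_toAF (a₁ a₂ : DualAF k) (G : Graph) :
    comp a₁ a₂ G.toAF = ∑ p : G.AdmissiblePartition, a₁ p.upper.toAF * a₂ p.lower.toAF :=
  rfl

theorem subst_toAF (b : DualAT k) (a : DualAF k) (G : Graph) :
    subst b a G.toAF =
      ∑ ρ : G.RootMap, a ρ.skeleton.toAF * ∏ r : ρ.Fix, b.toAF (ρ.part r).toAF := by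
  refine (Fintype.sum_equiv Graph.RootMap.partitionEquiv _ _ fun ρ => ?_).symm
  refine congrArg₂ _ (congrArg a ρ.toAF_skeleton_toPartition.symm)
    (Fintype.prod_equiv ρ.indexEquivFix _ _ fun B => ?_).symm
  rw [← ρ.toAF_part_toPartition]
  exact (DualAT.toAF_toAF b (ρ.toPartition.part_hasOneRoot B)).symm

theorem substAT_toAF (c b : DualAT k) : (substAT c b).toAF = subst c b.toAF := by
  refine DualAF.ext_toAF fun G => ?_
  by_cases hG : G.HasOneRoot
  · exact DualAT.toAF_toAF _ hG
  · rw [DualAT.toAF_eq_zero _ hG, subst_toAF]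
    refine (Finset.sum_eq_zero fun ρ _ => ?_).symm
    rw [DualAT.toAF_eq_zero _ (mt ρ.skeleton_hasOneRoot_iff.1 hG), zero_mul]

/-! ### Pairs of partitions -/

namespace Graph.RootMap

variable {G : Graph} {ι : Type*}

/-- A partition refines the decomposition of a graph into the subgraphs with vertices in the fibres
of `π` and edges in `F`. -/
structure Respects (ρ : G.RootMap) (π : G.V → ι) (F : Digraph G.V) : Prop where
  map_root : ∀ v, π (ρ.root v) = π v
  kept_le : ρ.kept ≤ F

/-- The graph on the roots of the classes in `W` whose edges come from edges of `F`. -/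
def skeletonSub (ρ : G.RootMap) (W : Set G.V) (F : Digraph G.V) (hF : F ≤ G.graph) : Graph :=
  ρ.skeleton.sub {r | r.1 ∈ W} ⟨fun r s => ∃ w, F.Adj r.1 w ∧ ρ.toFix w = s⟩
    fun _ _ ⟨w, h, hw⟩ => ⟨w, hF h, hw⟩

section Restrict

variable {ρ : G.RootMap} {π : G.V → ι} {F : Digraph G.V}

/-- The restriction of a partition to one of the subgraphs of a decomposition which it refines. -/
def restrict (h : ρ.Respects π F) (hF : F ≤ G.graph) (i : ι) :
    (G.sub {v | π v = i} F hF).RootMap where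
  root v := ⟨ρ.root v.1, (h.map_root v.1).trans v.2⟩
  root_root v := Subtype.ext (ρ.root_root v.1)
  exists_adj v hv := by
    have hv' : ρ.root v.1 ≠ v.1 := fun h => hv (Subtype.ext h)
    obtain ⟨w, hw, hroot⟩ := ρ.exists_adj v.1 hv'
    have hπ : π w = i := by rw [← h.map_root, hroot, h.map_root, v.2]
    exact ⟨⟨w, hπ⟩, h.kept_le ⟨hw, hv'⟩, Subtype.ext hroot⟩

/-- The partition whose restrictions to the subgraphs of a decomposition are given. -/
def glue (hF : F ≤ G.graph) (τ : ∀ i, (G.sub {v | π v = i} F hF).RootMap) :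
    {ρ : G.RootMap // ρ.Respects π F} :=
  let f : G.V → G.V := fun v => ((τ (π v)).root ⟨v, rfl⟩).1
  have hf : ∀ i (v : {v // π v = i}), f v.1 = ((τ i).root v).1 := by rintro _ ⟨v, rfl⟩; rfl
  have hadj : ∀ v, f v ≠ v → ∃ w, F.Adj v w ∧ f w = f v := fun v hv => by
    obtain ⟨w, hw, hroot⟩ := (τ (π v)).exists_adj ⟨v, rfl⟩ fun h => hv (congrArg Subtype.val h)
    exact ⟨w.1, hw, (hf _ w).trans (congrArg Subtype.val hroot)⟩
  { val.root := f
    val.root_root v := (hf _ _).trans (congrArg Subtype.val ((τ (π v)).root_root ⟨v, rfl⟩))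
    val.exists_adj v hv := (hadj v hv).imp fun _ h => ⟨hF h.1, h.2⟩
    property.map_root v := ((τ (π v)).root ⟨v, rfl⟩).2
    property.kept_le u v h := by
      obtain ⟨w, hw, -⟩ := hadj u h.2
      rwa [G.out_unique _ _ _ h.1 (hF hw)] }

/-- A partition refining a decomposition amounts to a partition of each of the subgraphs. -/
def restrictEquiv (π : G.V → ι) (hF : F ≤ G.graph) :
    {ρ : G.RootMap // ρ.Respects π F} ≃ ∀ i, (G.sub {v | π v = i} F hF).RootMap where
  toFun ρ := restrict ρ.2 hF
  invFun := glue hF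
  left_inv _ := rfl
  right_inv τ := by
    funext i
    refine RootMap.ext (funext fun ⟨v, hv⟩ => ?_)
    subst hv
    rfl

variable (h : ρ.Respects π F) (hF : F ≤ G.graph) (i : ι)

/-- The roots of the classes of a restriction. -/
def restrictFixEquiv : (restrict h hF i).Fix ≃ {r : ρ.Fix // π r.1 = i} where
  toFun s := ⟨⟨s.1.1, congrArg Subtype.val s.2⟩, s.1.2⟩
  invFun r := ⟨⟨r.1.1, r.2⟩, Subtype.ext r.1.2⟩

theorem toAF_skeleton_restrict :
    (restrict h hF i).skeleton.toAF = (ρ.skeletonSub {v | π v = i} F hF).toAF := by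
  refine Graph.toAF_eq ⟨restrictFixEquiv h hF i, fun {r s} => ⟨?_, ?_⟩⟩
  · rintro ⟨w, hw, hws⟩
    have hπ : π w = i := by
      rw [← h.map_root, ρ.toFix_eq_iff.1 hws]
      exact s.1.2
    exact ⟨⟨w, hπ⟩, hw, Subtype.ext (Subtype.ext (ρ.toFix_eq_iff.1 hws))⟩
  · rintro ⟨w, hw, rfl⟩
    exact ⟨w.1, hw, rfl⟩

theorem toAF_part_restrict (s : (restrict h hF i).Fix) :
    ((restrict h hF i).part s).toAF = (ρ.part (restrictFixEquiv h hF i s).1).toAF := by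
  have hiff (v : {v // π v = i}) : (restrict h hF i).toFix v = s ↔
      ρ.toFix v.1 = (restrictFixEquiv h hF i s).1 :=
    (restrictFixEquiv h hF i).apply_eq_iff_eq.symm.trans Subtype.ext_iff
  have hmem {v : G.V} (hv : ρ.toFix v = (restrictFixEquiv h hF i s).1) : π v = i := by
    rw [← h.map_root, ρ.toFix_eq_iff.1 hv]
    exact s.1.2
  refine Graph.toAF_eq ⟨⟨fun v => ⟨v.1.1, (hiff v.1).1 v.2⟩,
    fun v => ⟨⟨v.1, hmem v.2⟩, (hiff _).2 v.2⟩, fun _ => rfl, fun _ => rfl⟩, fun {u v} => ?_⟩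
  exact ⟨fun ⟨huv, hu⟩ => ⟨h.kept_le ⟨huv, hu⟩, fun hu' => hu (congrArg Subtype.val hu')⟩,
    fun ⟨huv, hu⟩ => ⟨hF huv, fun hu' => hu (Subtype.ext hu')⟩⟩

end Restrict

section Coarsening

/-- The classes of `ρ`, with their kept edges, lie in those of `σ`. -/
abbrev Refines (ρ σ : G.RootMap) : Prop := ρ.Respects σ.toFix σ.kept

variable {ρ σ : G.RootMap}

theorem Refines.root_root_left (h : ρ.Refines σ) (v : G.V) : σ.root (ρ.root v) = σ.root v :=
  congrArg Subtype.val (h.map_root v)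

theorem Refines.root_root_right (h : ρ.Refines σ) (v : G.V) : ρ.root (σ.root v) = σ.root v := by
  by_contra hne
  obtain ⟨w, hw, -⟩ := ρ.exists_adj _ hne
  exact (h.kept_le ⟨hw, hne⟩).2 (σ.root_root v)

variable (ρ) in
/-- The partition obtained by merging the classes of `ρ` along a partition of the skeleton. -/
def coarsen (q : ρ.skeleton.RootMap) : G.RootMap where
  root v := (q.root (ρ.toFix v)).1
  root_root v := (congrArg (fun r => (q.root r).1) (ρ.toFix_coe _)).trans
    (congrArg Subtype.val (q.root_root _))
  exists_adj v hv := by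
    by_cases hfix : ρ.root v = v
    · have hv' : ρ.toFix v = ⟨v, hfix⟩ := Subtype.ext hfix
      rw [hv'] at hv ⊢
      obtain ⟨_, ⟨w, hw, rfl⟩, hroot⟩ := q.exists_adj _ fun h => hv (congrArg Subtype.val h)
      exact ⟨w, hw, congrArg Subtype.val hroot⟩
    · obtain ⟨w, hw, hroot⟩ := ρ.exists_adj v hfix
      exact ⟨w, hw, by rw [show ρ.toFix w = ρ.toFix v from Subtype.ext hroot]⟩

theorem coarsen_root (q : ρ.skeleton.RootMap) (r : ρ.Fix) :
    (ρ.coarsen q).root r.1 = (q.root r).1 :=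
  congrArg (fun r => (q.root r).1) (ρ.toFix_coe r)

theorem refines_coarsen (q : ρ.skeleton.RootMap) : ρ.Refines (ρ.coarsen q) where
  map_root v := Subtype.ext (coarsen_root q (ρ.toFix v))
  kept_le u v h := by
    refine ⟨h.1, fun hu => h.2 ?_⟩
    rw [← hu]
    exact (q.root (ρ.toFix u)).2

/-- The partitions of the skeleton of `ρ` are the partitions that `ρ` refines. -/
def coarseningEquiv (ρ : G.RootMap) : ρ.skeleton.RootMap ≃ {σ : G.RootMap // ρ.Refines σ} where
  toFun q := ⟨ρ.coarsen q, refines_coarsen q⟩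
  invFun σ :=
    { root := fun r => ⟨σ.1.root r.1, σ.2.root_root_right r.1⟩
      root_root := fun r => Subtype.ext (σ.1.root_root r.1)
      exists_adj := fun r hr => by
        obtain ⟨w, hw, hroot⟩ := σ.1.exists_adj r.1 fun h => hr (Subtype.ext h)
        exact ⟨ρ.toFix w, ⟨w, hw, rfl⟩, Subtype.ext ((σ.2.root_root_left w).trans hroot)⟩ }
  left_inv q := RootMap.ext (funext fun r => Subtype.ext (coarsen_root q r))
  right_inv σ := Subtype.ext (RootMap.ext (funext σ.2.root_root_left))

/-- The roots of the classes of a coarsening. -/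
def coarsenFixEquiv (q : ρ.skeleton.RootMap) : q.Fix ≃ (ρ.coarsen q).Fix where
  toFun s := ⟨s.1.1, (coarsen_root q s.1).trans (congrArg Subtype.val s.2)⟩
  invFun v := ⟨⟨v.1, by rw [← v.2]; exact (q.root _).2⟩,
    Subtype.ext ((coarsen_root q _).symm.trans v.2)⟩

theorem coarsenFixEquiv_toFix (q : ρ.skeleton.RootMap) (r : ρ.Fix) :
    coarsenFixEquiv q (q.toFix r) = (ρ.coarsen q).toFix r.1 :=
  Subtype.ext (coarsen_root q r).symm

theorem toAF_skeleton_coarsen (q : ρ.skeleton.RootMap) :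
    q.skeleton.toAF = (ρ.coarsen q).skeleton.toAF := by
  refine Graph.toAF_eq ⟨coarsenFixEquiv q, fun {r s} => ⟨?_, ?_⟩⟩
  · rintro ⟨w, hw, hws⟩
    exact ⟨ρ.toFix w, ⟨w, hw, rfl⟩, (coarsenFixEquiv q).injective hws⟩
  · rintro ⟨_, ⟨w, hw, rfl⟩, rfl⟩
    exact ⟨w, hw, rfl⟩

theorem toAF_part_coarsen (q : ρ.skeleton.RootMap) (s : q.Fix) :
    (q.part s).toAF = (ρ.skeletonSub {v | (ρ.coarsen q).toFix v = coarsenFixEquiv q s}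
      (ρ.coarsen q).kept (ρ.coarsen q).kept_le).toAF := by
  have hclass (r : ρ.Fix) :
      q.toFix r = s ↔ (ρ.coarsen q).toFix r.1 = coarsenFixEquiv q s := by
    rw [← coarsenFixEquiv_toFix, Equiv.apply_eq_iff_eq]
  have hfix (r : ρ.Fix) : (ρ.coarsen q).root r.1 = r.1 ↔ q.root r = r := by
    rw [coarsen_root]
    exact Subtype.ext_iff.symm
  exact Graph.toAF_eq <| subIso (Equiv.refl _) _ _ hclass fun r t =>
    ⟨fun ⟨w, ⟨hw, hr⟩, hwt⟩ => ⟨⟨w, hw, hwt⟩, fun h => hr ((hfix r).2 h)⟩,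
      fun ⟨⟨w, hw, hwt⟩, hr⟩ => ⟨w, ⟨hw, fun h => hr ((hfix r).1 h)⟩, hwt⟩⟩

end Coarsening

section Admissible

variable (ρ : G.RootMap)

/-- The admissible partitions of the skeleton of `ρ` are the admissible partitions that do not
separate any class of `ρ`. -/
def admissibleEquiv : ρ.skeleton.AdmissiblePartition ≃
    {p : G.AdmissiblePartition // ρ.Respects (· ∈ p.R) G.graph} where
  toFun q := ⟨{
    R := {v | ρ.toFix v ∈ q.R}
    no_edge := fun u hu v hv huv => by
      by_cases hfix : ρ.root u = u
      · exact q.no_edge _ hu _ hv ⟨v, (congrArg (G.graph.Adj · v) hfix).mpr huv, rfl⟩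
      · exact hv (show ρ.toFix v ∈ q.R from (ρ.toFix_eq_of_adj huv hfix).symm ▸ hu) },
    fun v => congrArg (· ∈ q.R) (ρ.toFix_coe (ρ.toFix v)), ρ.kept_le⟩
  invFun p :=
    { R := {r | r.1 ∈ p.1.R}
      no_edge := by
        rintro r hr _ hs ⟨w, hw, rfl⟩
        exact p.1.no_edge _ hr w (fun hwR => hs ((iff_of_eq (p.2.map_root w)).2 hwR)) hw }
  left_inv q := AdmissiblePartition.ext (Set.ext fun r =>
    iff_of_eq (congrArg (· ∈ q.R) (ρ.toFix_coe r)))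
  right_inv p := Subtype.ext (AdmissiblePartition.ext (Set.ext fun v =>
    iff_of_eq (p.2.map_root v)))

variable {ρ} (q : ρ.skeleton.AdmissiblePartition)

theorem mem_admissibleEquiv {r : ρ.Fix} : r.1 ∈ (ρ.admissibleEquiv q).1.R ↔ r ∈ q.R :=
  iff_of_eq (congrArg (· ∈ q.R) (ρ.toFix_coe r))

theorem toAF_lower_admissibleEquiv :
    q.lower.toAF = (ρ.skeletonSub (ρ.admissibleEquiv q).1.R G.graph le_rfl).toAF :=
  Graph.toAF_eq (subIso (Equiv.refl _) le_rfl _ (fun _ => (mem_admissibleEquiv q).symm)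
    fun _ _ => Iff.rfl)

theorem toAF_upper_admissibleEquiv :
    q.upper.toAF = (ρ.skeletonSub (ρ.admissibleEquiv q).1.Rᶜ G.graph le_rfl).toAF :=
  Graph.toAF_eq (subIso (Equiv.refl _) le_rfl _ (fun _ => not_congr (mem_admissibleEquiv q).symm)
    fun _ _ => Iff.rfl)

end Admissible

end Graph.RootMap

section Action

open Graph.RootMap

variable (b c : DualAT k) {G : Graph}

open scoped Classical in
theorem prod_subst_fiber {ι : Type*} [Fintype ι] (π : G.V → ι) {F : Digraph G.V}
    (hF : F ≤ G.graph) (a : ι → DualAF k) :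
    ∏ i, subst b (a i) (G.sub {v | π v = i} F hF).toAF =
      ∑ ρ : G.RootMap with ρ.Respects π F,
        (∏ i, a i (ρ.skeletonSub {v | π v = i} F hF).toAF) *
          ∏ r : ρ.Fix, b.toAF (ρ.part r).toAF := by
  simp only [subst_toAF]
  rw [Finset.prod_univ_sum, Fintype.piFinset_univ]
  refine sum_eq_sum_filter_of_equiv (restrictEquiv π hF).symm fun τ => ?_
  obtain ⟨⟨ρ, h⟩, rfl⟩ := (restrictEquiv π hF).surjective τ
  rw [Equiv.symm_apply_apply, Finset.prod_mul_distrib,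
    ← Fintype.prod_fiberwise fun r : ρ.Fix => π r.1]
  refine congrArg₂ _ (Finset.prod_congr rfl fun i _ => ?_) (Finset.prod_congr rfl fun i _ => ?_)
  · exact congrArg (a i) (toAF_skeleton_restrict h hF i)
  · exact Fintype.prod_equiv (restrictFixEquiv h hF i) _ _ fun s =>
      congrArg b.toAF (toAF_part_restrict h hF i s)

open scoped Classical in
theorem subst_skeleton_toAF (a : DualAF k) (ρ : G.RootMap) :
    subst b a ρ.skeleton.toAF = ∑ σ : G.RootMap with ρ.Refines σ, a σ.skeleton.toAF *
      ∏ s : σ.Fix, b.toAF (ρ.skeletonSub {v | σ.toFix v = s} σ.kept σ.kept_le).toAF := by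
  rw [subst_toAF]
  refine sum_eq_sum_filter_of_equiv ρ.coarseningEquiv fun q => ?_
  exact congrArg₂ _ (congrArg a (toAF_skeleton_coarsen q)) <|
    Fintype.prod_equiv (coarsenFixEquiv q) _ _ fun s => congrArg b.toAF (toAF_part_coarsen q s)

theorem subst_subst (a : DualAF k) : subst c (subst b a) = subst (substAT c b) a := by
  classical
  refine DualAF.ext_toAF fun G => ?_
  let B (ρ σ : G.RootMap) : k :=
    ∏ s : σ.Fix, b.toAF (ρ.skeletonSub {v | σ.toFix v = s} σ.kept σ.kept_le).toAF
  let C (ρ : G.RootMap) : k := ∏ r : ρ.Fix, c.toAF (ρ.part r).toAF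
  calc subst c (subst b a) G.toAF
      = ∑ ρ : G.RootMap, ∑ σ with ρ.Refines σ, a σ.skeleton.toAF * B ρ σ * C ρ := by
        simp only [subst_toAF c, subst_skeleton_toAF, Finset.sum_mul, B, C]
    _ = ∑ σ : G.RootMap, ∑ ρ with ρ.Refines σ, a σ.skeleton.toAF * B ρ σ * C ρ :=
        Finset.sum_comm' (by simp)
    _ = ∑ σ : G.RootMap, a σ.skeleton.toAF * ∏ s : σ.Fix, subst c b.toAF (σ.part s).toAF := by
        refine Finset.sum_congr rfl fun σ _ => ?_
        simp only [part, prod_subst_fiber, Finset.mul_sum, mul_assoc, B, C]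
    _ = subst (substAT c b) a G.toAF := by simp only [subst_toAF (substAT c b), substAT_toAF]

open scoped Classical in
theorem comp_skeleton_toAF (a₁ a₂ : DualAF k) (ρ : G.RootMap) :
    comp a₁ a₂ ρ.skeleton.toAF =
      ∑ p : G.AdmissiblePartition with ρ.Respects (· ∈ p.R) G.graph,
        a₁ (ρ.skeletonSub p.Rᶜ G.graph le_rfl).toAF *
          a₂ (ρ.skeletonSub p.R G.graph le_rfl).toAF := by
  rw [comp_toAF]
  exact sum_eq_sum_filter_of_equiv ρ.admissibleEquiv fun q =>
    congrArg₂ _ (congrArg a₁ (toAF_upper_admissibleEquiv q))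
      (congrArg a₂ (toAF_lower_admissibleEquiv q))

open scoped Classical in
theorem subst_upper_mul_subst_lower (a₁ a₂ : DualAF k) (p : G.AdmissiblePartition) :
    subst b a₁ p.upper.toAF * subst b a₂ p.lower.toAF =
      ∑ ρ : G.RootMap with ρ.Respects (· ∈ p.R) G.graph,
        a₁ (ρ.skeletonSub p.Rᶜ G.graph le_rfl).toAF *
          a₂ (ρ.skeletonSub p.R G.graph le_rfl).toAF * ∏ r : ρ.Fix, b.toAF (ρ.part r).toAF := by
  have hlower : {v | (v ∈ p.R) = True} = p.R := by simp
  have hupper : {v | (v ∈ p.R) = False} = p.Rᶜ := by simp [Set.compl_def]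
  have h := prod_subst_fiber b (· ∈ p.R) le_rfl fun i : Prop => if i then a₂ else a₁
  simp only [Fintype.prod_Prop, if_true, if_false, hlower, hupper] at h
  rw [mul_comm]
  exact h.trans (Finset.sum_congr rfl fun ρ _ => by rw [mul_comm (a₂ _)])

theorem subst_comp (a₁ a₂ : DualAF k) :
    subst b (comp a₁ a₂) = comp (subst b a₁) (subst b a₂) := by
  classical
  refine DualAF.ext_toAF fun G => ?_
  simp only [subst_toAF b (comp a₁ a₂), comp_skeleton_toAF, Finset.sum_mul,
    comp_toAF (subst b a₁), subst_upper_mul_subst_lower]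
  exact Finset.sum_comm' (by simp)

end Action

/-! ### The composition algebra -/

namespace Graph

theorem toAF_induce_induce (G : Graph) {W T : Set G.V} {S : Set (G.induce W).V}
    (h : ∀ v, v ∈ T ↔ ∃ hv : v ∈ W, (⟨v, hv⟩ : (G.induce W).V) ∈ S) :
    ((G.induce W).induce S).toAF = (G.induce T).toAF :=
  Graph.toAF_eq ⟨⟨fun v => ⟨v.1.1, (h _).2 ⟨v.1.2, v.2⟩⟩,
    fun v => ⟨⟨v.1, ((h _).1 v.2).1⟩, ((h _).1 v.2).2⟩, fun _ => rfl, fun _ => rfl⟩, Iff.rfl⟩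

namespace AdmissiblePartition

variable {G : Graph} (p : G.AdmissiblePartition)

/-- The admissible partitions of `P*(p)` are the admissible partitions of the whole graph whose
subgraph `R` contains `R(p)`. -/
def upperEquiv : p.upper.AdmissiblePartition ≃ {p' : G.AdmissiblePartition // p.R ⊆ p'.R} where
  toFun q := ⟨{
    R := {v | ∀ hv : v ∈ p.Rᶜ, (⟨v, hv⟩ : (G.induce p.Rᶜ).V) ∈ q.R}
    no_edge := fun u hu v hv h => by
      obtain ⟨hvp, hvq⟩ := not_forall.1 hv
      by_cases hup : u ∈ p.R
      · exact p.no_edge u hup v hvp h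
      · exact q.no_edge _ (hu hup) _ hvq h }, fun _ hv hv' => absurd hv hv'⟩
  invFun p' := ⟨{v | v.1 ∈ p'.1.R}, fun u hu v hv h => p'.1.no_edge u.1 hu v.1 hv h⟩
  left_inv _ := AdmissiblePartition.ext (Set.ext fun v => ⟨fun h => h v.2, fun h _ => h⟩)
  right_inv p' := Subtype.ext <| AdmissiblePartition.ext <| Set.ext fun _ =>
    ⟨fun h => by_contra fun hv => hv (h fun hv' => hv (p'.2 hv')), fun h _ => h⟩

/-- The admissible partitions of `R(p)` are the admissible partitions of the whole graph whose
subgraph `R` is contained in `R(p)`. -/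
def lowerEquiv : p.lower.AdmissiblePartition ≃ {p' : G.AdmissiblePartition // p'.R ⊆ p.R} where
  toFun q := ⟨{
    R := {v | ∃ hv : v ∈ p.R, (⟨v, hv⟩ : (G.induce p.R).V) ∈ q.R}
    no_edge := fun u ⟨hup, huq⟩ v hv h => by
      by_cases hvp : v ∈ p.R
      · exact q.no_edge _ huq ⟨v, hvp⟩ (fun h' => hv ⟨hvp, h'⟩) h
      · exact p.no_edge u hup v hvp h }, fun _ hv => hv.1⟩
  invFun p' := ⟨{v | v.1 ∈ p'.1.R}, fun u hu v hv h => p'.1.no_edge u.1 hu v.1 hv h⟩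
  left_inv _ := AdmissiblePartition.ext (Set.ext fun v => ⟨fun h => h.2, fun h => ⟨v.2, h⟩⟩)
  right_inv p' := Subtype.ext <| AdmissiblePartition.ext <| Set.ext fun _ =>
    ⟨fun h => h.2, fun h => ⟨p'.2 h, h⟩⟩

theorem toAF_upper_upperEquiv (q : p.upper.AdmissiblePartition) :
    q.upper.toAF = (p.upperEquiv q).1.upper.toAF :=
  G.toAF_induce_induce fun _ => not_forall

theorem toAF_lower_upperEquiv (q : p.upper.AdmissiblePartition) :
    q.lower.toAF = (G.induce ((p.upperEquiv q).1.R \ p.R)).toAF :=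
  G.toAF_induce_induce fun _ => ⟨fun h => ⟨h.2, h.1 h.2⟩, fun h => ⟨fun _ => h.2, h.1⟩⟩

theorem toAF_lower_lowerEquiv (q : p.lower.AdmissiblePartition) :
    q.lower.toAF = (p.lowerEquiv q).1.lower.toAF :=
  G.toAF_induce_induce fun _ => Iff.rfl

theorem toAF_upper_lowerEquiv (q : p.lower.AdmissiblePartition) :
    q.upper.toAF = (G.induce (p.R \ (p.lowerEquiv q).1.R)).toAF :=
  G.toAF_induce_induce fun _ =>
    ⟨fun h => ⟨h.1, fun h' => h.2 ⟨h.1, h'⟩⟩, fun h => ⟨h.1, fun h' => h.2 h'.2⟩⟩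

end AdmissiblePartition

end Graph

section Composition

variable {G : Graph}

open scoped Classical in
theorem comp_upper_toAF (a₁ a₂ : DualAF k) (p : G.AdmissiblePartition) :
    comp a₁ a₂ p.upper.toAF = ∑ p' : G.AdmissiblePartition with p.R ⊆ p'.R,
      a₁ p'.upper.toAF * a₂ (G.induce (p'.R \ p.R)).toAF := by
  rw [comp_toAF]
  exact sum_eq_sum_filter_of_equiv p.upperEquiv fun q => by
    rw [p.toAF_upper_upperEquiv, p.toAF_lower_upperEquiv]

open scoped Classical in
theorem comp_lower_toAF (a₁ a₂ : DualAF k) (p : G.AdmissiblePartition) :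
    comp a₁ a₂ p.lower.toAF = ∑ p' : G.AdmissiblePartition with p'.R ⊆ p.R,
      a₁ (G.induce (p.R \ p'.R)).toAF * a₂ p'.lower.toAF := by
  rw [comp_toAF]
  exact sum_eq_sum_filter_of_equiv p.lowerEquiv fun q => by
    rw [p.toAF_lower_lowerEquiv, p.toAF_upper_lowerEquiv]

theorem comp_assoc (a₁ a₂ a₃ : DualAF k) : comp (comp a₁ a₂) a₃ = comp a₁ (comp a₂ a₃) := by
  classical
  refine DualAF.ext_toAF fun G => ?_
  simp only [comp_toAF (comp a₁ a₂), comp_toAF a₁ (comp a₂ a₃), comp_upper_toAF, comp_lower_toAF,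
    Finset.sum_mul, Finset.mul_sum, mul_assoc]
  exact Finset.sum_comm' (by simp)

theorem comp_linear_left (α₁ α₂ : k) (a₁ a₂ a : DualAF k) :
    comp (α₁ • a₁ + α₂ • a₂) a = α₁ • comp a₁ a + α₂ • comp a₂ a := by
  refine DualAF.ext_toAF fun G => ?_
  simp only [comp_toAF, Pi.add_apply, Pi.smul_apply, smul_eq_mul, add_mul, mul_assoc,
    Finset.mul_sum, Finset.sum_add_distrib]

theorem comp_linear_right (α₁ α₂ : k) (a₁ a₂ a : DualAF k) :
    comp a (α₁ • a₁ + α₂ • a₂) = α₁ • comp a a₁ + α₂ • comp a a₂ := by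
  refine DualAF.ext_toAF fun G => ?_
  simp only [comp_toAF, Pi.add_apply, Pi.smul_apply, smul_eq_mul, mul_add, mul_left_comm,
    Finset.mul_sum, Finset.sum_add_distrib]

theorem subst_linear (b : DualAT k) (α₁ α₂ : k) (a₁ a₂ : DualAF k) :
    subst b (α₁ • a₁ + α₂ • a₂) = α₁ • subst b a₁ + α₂ • subst b a₂ := by
  refine DualAF.ext_toAF fun G => ?_
  simp only [subst_toAF, Pi.add_apply, Pi.smul_apply, smul_eq_mul, add_mul, mul_assoc,
    Finset.mul_sum, Finset.sum_add_distrib]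

end Composition

namespace Graph

variable {G : Graph}

theorem toAF_eq_iff {H : Graph} : G.toAF = H.toAF ↔ G.Iso H :=
  Quotient.eq (r := Graph.isoSetoid)

theorem toAF_eq_empty_iff : G.toAF = AF.empty ↔ IsEmpty G.V :=
  ⟨fun h => (toAF_eq_iff.1 h).elim fun e => ⟨fun v => (e v).elim⟩,
    fun _ => Graph.toAF_eq ⟨Equiv.equivOfIsEmpty G.V Empty, fun {u} => isEmptyElim u⟩⟩

namespace AdmissiblePartition

variable {p : G.AdmissiblePartition}

/-- The admissible partition whose subgraph `R` is the whole graph. -/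
instance : Top G.AdmissiblePartition := ⟨Set.univ, fun _ _ _ hv => absurd trivial hv⟩

/-- The admissible partition whose subgraph `P*` is the whole graph. -/
instance : Bot G.AdmissiblePartition := ⟨∅, fun _ hu => absurd hu (Set.notMem_empty _)⟩

theorem toAF_upper_eq_empty_iff : p.upper.toAF = AF.empty ↔ p = ⊤ := by
  rw [toAF_eq_empty_iff, AdmissiblePartition.ext_iff]
  exact Set.isEmpty_coe_sort.trans Set.compl_empty_iff

theorem toAF_lower_eq_empty_iff : p.lower.toAF = AF.empty ↔ p = ⊥ := by
  rw [toAF_eq_empty_iff, AdmissiblePartition.ext_iff]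
  exact Set.isEmpty_coe_sort

theorem toAF_lower_top : (⊤ : G.AdmissiblePartition).lower.toAF = G.toAF :=
  Graph.toAF_eq ⟨Equiv.Set.univ _, Iff.rfl⟩

theorem toAF_upper_bot : (⊥ : G.AdmissiblePartition).upper.toAF = G.toAF :=
  Graph.toAF_eq ⟨Equiv.subtypeUnivEquiv Set.notMem_empty, Iff.rfl⟩

theorem card_lower_lt (hp : p ≠ ⊤) : Nat.card p.lower.V < Nat.card G.V := by
  obtain ⟨v, hv⟩ := (Set.ne_univ_iff_exists_notMem _).1 fun h => hp (AdmissiblePartition.ext h)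
  exact Finite.card_subtype_lt hv

instance [IsEmpty G.V] : Subsingleton G.AdmissiblePartition :=
  ⟨fun _ _ => AdmissiblePartition.ext (Subsingleton.elim _ _)⟩

end AdmissiblePartition

theorem RootMap.toAF_skeleton_eq_empty_iff (ρ : G.RootMap) :
    ρ.skeleton.toAF = AF.empty ↔ G.toAF = AF.empty := by
  rw [toAF_eq_empty_iff, toAF_eq_empty_iff]
  exact ⟨fun h => ⟨fun v => h.elim (ρ.toFix v)⟩, fun h => ⟨fun r => h.elim r.1⟩⟩

instance [IsEmpty G.V] : Unique G.RootMap where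
  default := ⟨id, fun _ => rfl, fun v => isEmptyElim v⟩
  uniq _ := RootMap.ext (Subsingleton.elim _ _)

end Graph

section Unit

open Graph.AdmissiblePartition

theorem counit_empty : counit k AF.empty = 1 := if_pos rfl

theorem counit_apply_of_ne {φ : AF} (h : φ ≠ AF.empty) : counit k φ = 0 := if_neg h

theorem counit_comp (a : DualAF k) : comp (counit k) a = a := by
  refine DualAF.ext_toAF fun G => ?_
  rw [comp_toAF, Fintype.sum_eq_single ⊤ fun p hp => ?_, toAF_upper_eq_empty_iff.2 rfl,
    counit_empty, one_mul, toAF_lower_top]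
  rw [counit_apply_of_ne (mt toAF_upper_eq_empty_iff.1 hp), zero_mul]

theorem comp_counit (a : DualAF k) : comp a (counit k) = a := by
  refine DualAF.ext_toAF fun G => ?_
  rw [comp_toAF, Fintype.sum_eq_single ⊥ fun p hp => ?_, toAF_lower_eq_empty_iff.2 rfl,
    counit_empty, mul_one, toAF_upper_bot]
  rw [counit_apply_of_ne (mt toAF_lower_eq_empty_iff.1 hp), mul_zero]

theorem comp_empty (a₁ a₂ : DualAF k) : comp a₁ a₂ AF.empty = a₁ AF.empty * a₂ AF.empty := by
  have : IsEmpty Graph.empty.V := inferInstanceAs (IsEmpty Empty)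
  refine (Fintype.sum_subsingleton _ (⊤ : Graph.empty.AdmissiblePartition)).trans ?_
  rw [toAF_upper_eq_empty_iff.2 rfl, toAF_lower_top, AF.empty]

/-- The number of nodes of an aromatic forest. -/
def AF.size : AF → ℕ :=
  Quotient.lift (fun G : Graph => Nat.card G.V) fun _ _ ⟨e⟩ => Nat.card_congr e.toEquiv

theorem comp_bijective {a : DualAF k} (ha : a AF.empty ≠ 0) : Function.Bijective (comp a) := by
  refine bijective_of_triangular (InvImage.wf AF.size wellFounded_lt)
    (fun _ => isUnit_iff_ne_zero.2 ha) fun f g φ hfg => ?_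
  obtain ⟨G, rfl⟩ := Quotient.exists_rep φ
  change comp a f G.toAF - comp a g G.toAF = _ * (f G.toAF - g G.toAF)
  rw [comp_toAF, comp_toAF, ← Finset.sum_sub_distrib, Fintype.sum_eq_single ⊤ fun p hp => ?_,
    toAF_upper_eq_empty_iff.2 rfl, toAF_lower_top, mul_sub]
  rw [hfg p.lower.toAF (card_lower_lt hp), sub_self]

theorem apply_empty_ne_zero_of_comp_eq_counit {a x : DualAF k} (h : comp a x = counit k) :
    a AF.empty ≠ 0 := by
  refine left_ne_zero_of_mul (b := x AF.empty) ?_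
  rw [← comp_empty, h, counit_empty]
  exact one_ne_zero

theorem isCompInverse_of_comp_eq_counit {a x : DualAF k} (h : comp a x = counit k) :
    IsCompInverse a x :=
  ⟨h, (comp_bijective (apply_empty_ne_zero_of_comp_eq_counit h)).injective
    (by rw [← comp_assoc, h, counit_comp, comp_counit])⟩

theorem exists_isCompInverse_iff (a : DualAF k) :
    (∃ a', IsCompInverse a a') ↔ a AF.empty ≠ 0 :=
  ⟨fun ⟨_, h⟩ => apply_empty_ne_zero_of_comp_eq_counit h.1,
    fun ha => ((comp_bijective ha).surjective _).imp fun _ => isCompInverse_of_comp_eq_counit⟩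

theorem subst_counit (b : DualAT k) : subst b (counit k) = counit k := by
  refine DualAF.ext_toAF fun G => ?_
  rw [subst_toAF]
  by_cases hG : G.toAF = AF.empty
  · have := Graph.toAF_eq_empty_iff.1 hG
    have hFix (ρ : G.RootMap) : IsEmpty ρ.Fix := ⟨fun r => isEmptyElim r.1⟩
    rw [Fintype.sum_unique, Fintype.prod_empty, mul_one, hG,
      (Graph.RootMap.toAF_skeleton_eq_empty_iff _).2 hG]
  · rw [counit_apply_of_ne hG]
    refine Finset.sum_eq_zero fun ρ _ => ?_
    rw [counit_apply_of_ne (mt ρ.toAF_skeleton_eq_empty_iff.1 hG), zero_mul]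

theorem IsCompInverse.subst (b : DualAT k) {a a' : DualAF k} (h : IsCompInverse a a') :
    IsCompInverse (subst b a) (subst b a') :=
  ⟨by rw [← subst_comp, h.1, subst_counit], by rw [← subst_comp, h.2, subst_counit]⟩

end Unit

/-! ### The substitution group -/

namespace Graph

variable {G : Graph}

theorem toAF_eq_bullet_iff : G.toAF = bullet.toAF ↔ Subsingleton G.V ∧ G.HasOneRoot := by
  refine ⟨fun h => ?_, fun ⟨_, r, hr, _⟩ => ?_⟩
  · have hiso := toAF_eq_iff.1 h
    exact ⟨hiso.elim fun e => e.injective.subsingleton (β := Unit),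
      hiso.symm.hasOneRoot bullet_hasOneRoot⟩
  · exact Graph.toAF_eq ⟨⟨fun _ => (), fun _ => r, fun _ => Subsingleton.elim _ _, fun _ => rfl⟩,
      fun {u v} => ⟨False.elim, fun h => hr v (Subsingleton.elim u r ▸ h)⟩⟩

namespace RootMap

/-- The partition whose classes are the single vertices. -/
instance : Bot G.RootMap := ⟨id, fun _ => rfl, fun _ hv => absurd rfl hv⟩

theorem toAF_skeleton_bot : (⊥ : G.RootMap).skeleton.toAF = G.toAF :=
  Graph.toAF_eq ⟨Equiv.subtypeUnivEquiv fun _ => rfl, fun {_ s} =>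
    ⟨fun h => ⟨s.1, h, Subtype.ext rfl⟩, by
      rintro ⟨w, hw, rfl⟩
      exact hw⟩⟩

theorem toAF_part_bot (r : (⊥ : G.RootMap).Fix) :
    ((⊥ : G.RootMap).part r).toAF = bullet.toAF := by
  refine toAF_eq_bullet_iff.2 ⟨⟨fun u v => Subtype.ext ?_⟩, part_hasOneRoot _ r⟩
  exact (toFix_eq_iff _).1 u.2 |>.trans ((toFix_eq_iff _).1 v.2).symm

theorem eq_bot_of_forall_toAF_part_eq_bullet {ρ : G.RootMap}
    (h : ∀ r, (ρ.part r).toAF = bullet.toAF) : ρ = ⊥ := by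
  refine RootMap.ext (funext fun v => ?_)
  have := (toAF_eq_bullet_iff.1 (h (ρ.toFix v))).1
  exact congrArg Subtype.val (this.elim ⟨ρ.root v, ρ.toFix_coe (ρ.toFix v)⟩ ⟨v, rfl⟩)

end RootMap

namespace Partition

variable (p : G.Partition)

theorem skeleton_hasOneRoot_iff : p.skeleton.HasOneRoot ↔ G.HasOneRoot := by
  obtain ⟨ρ, rfl⟩ := RootMap.partitionEquiv.surjective p
  exact (iff_of_eq (congrArg AF.HasOneRoot ρ.toAF_skeleton_toPartition)).trans
    ρ.skeleton_hasOneRoot_iff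

variable {p}

theorem IsTrivial.toIndex_eq (h : p.IsTrivial) (u v : G.V) : p.toIndex u = p.toIndex v :=
  p.toIndex_eq_iff.2 (h.1 ▸ trivial)

theorem IsTrivial.subsingleton_index (h : p.IsTrivial) : Subsingleton p.Index :=
  ⟨p.toIndex_surjective.forall₂.2 h.toIndex_eq⟩

theorem isTrivial_of_subsingleton_index (hG : G.HasOneRoot) [Subsingleton p.Index] :
    p.IsTrivial := by
  have hindex (u v : G.V) : p.toIndex u = p.toIndex v := Subsingleton.elim _ _
  refine ⟨Setoid.ext fun u v => ⟨fun _ => trivial, fun _ => p.toIndex_eq_iff.1 (hindex u v)⟩,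
    le_antisymm p.kept_le fun u v huv => ?_⟩
  obtain ⟨r, hr, -⟩ := hG
  have hroot (w : G.V) : p.classRoot (p.toIndex w) = r :=
    p.classRoot_toIndex_eq_iff.2 ⟨hindex w r, fun x hx => hr x (p.kept_le hx)⟩
  have hu : p.classRoot (p.toIndex u) ≠ u := by
    rw [hroot]
    rintro rfl
    exact hr v huv
  obtain ⟨w, hw⟩ := p.classRoot_toIndex_ne_iff.1 hu
  rwa [G.out_unique _ _ _ huv (p.kept_le hw)]

theorem toAF_skeleton_eq_bullet_iff (hG : G.HasOneRoot) :
    p.skeleton.toAF = bullet.toAF ↔ p.IsTrivial :=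
  toAF_eq_bullet_iff.trans
    ⟨fun ⟨h, _⟩ => have : Subsingleton p.Index := h; isTrivial_of_subsingleton_index hG,
      fun h => ⟨h.subsingleton_index, p.skeleton_hasOneRoot_iff.2 hG⟩⟩

theorem IsTrivial.toAF_part (h : p.IsTrivial) (B : p.Index) : (p.part B).toAF = G.toAF := by
  obtain ⟨w, rfl⟩ := p.toIndex_surjective B
  exact Graph.toAF_eq ⟨Equiv.subtypeUnivEquiv fun v => h.toIndex_eq v w,
    fun {u v} => iff_of_eq (congrArg (Digraph.Adj · u.1 v.1) h.2.symm)⟩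

theorem card_part_lt (hG : G.HasOneRoot) (hp : ¬ p.IsTrivial) (B : p.Index) :
    Nat.card (p.part B).V < Nat.card G.V := by
  obtain ⟨w, hw⟩ : ∃ w, p.toIndex w ≠ B := by
    by_contra! h
    have : Subsingleton p.Index :=
      ⟨p.toIndex_surjective.forall₂.2 fun u v => (h u).trans (h v).symm⟩
    exact hp (isTrivial_of_subsingleton_index hG)
  exact Finite.card_subtype_lt hw

theorem existsUnique_isTrivial (hG : G.HasOneRoot) : ∃! p : G.Partition, p.IsTrivial := by
  refine ⟨⟨⊤, G.graph, le_rfl, fun _ _ _ => trivial, fun B => ?_⟩, ⟨rfl, rfl⟩,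
    fun p hp => Partition.ext hp.1 hp.2⟩
  obtain ⟨w, rfl⟩ := Quotient.exists_rep B
  exact Iso.hasOneRoot ⟨RelIso.symm ⟨Equiv.subtypeUnivEquiv fun v =>
    Quotient.sound (s := (⊤ : Setoid G.V)) trivial, Iff.rfl⟩⟩ hG

end Partition

end Graph

section Substitution

open Graph.RootMap

theorem bulletDual_bullet : bulletDual k AT.bullet = 1 := if_pos rfl

theorem bulletDual_toAT_of_ne {G : Graph} (hG : G.HasOneRoot) (h : G.toAF ≠ Graph.bullet.toAF) :
    bulletDual k (G.toAT hG) = 0 :=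
  if_neg fun hbullet => h (congrArg Subtype.val hbullet)

theorem toAF_bulletDual_bullet : (bulletDual k).toAF Graph.bullet.toAF = 1 :=
  (DualAT.toAF_toAF _ Graph.bullet_hasOneRoot).trans bulletDual_bullet

theorem bulletDual_subst (a : DualAF k) : subst (bulletDual k) a = a := by
  refine DualAF.ext_toAF fun G => ?_
  rw [subst_toAF, Fintype.sum_eq_single ⊥ fun ρ hρ => ?_,
    Finset.prod_eq_one fun r _ => by rw [toAF_part_bot, toAF_bulletDual_bullet], mul_one,
    toAF_skeleton_bot]
  obtain ⟨r, hr⟩ := not_forall.1 (mt eq_bot_of_forall_toAF_part_eq_bullet hρ)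
  rw [Finset.prod_eq_zero (Finset.mem_univ r), mul_zero]
  rw [DualAT.toAF_toAF _ (ρ.part_hasOneRoot r), bulletDual_toAT_of_ne _ hr]

theorem substAT_toAT (x b : DualAT k) {G : Graph} (hG : G.HasOneRoot) :
    substAT x b (G.toAT hG) = b AT.bullet * x (G.toAT hG) +
      ∑ p : {p : G.Partition // ¬ p.IsTrivial}, b.toAF p.1.skeleton.toAF *
        ∏ B : p.1.Index, x ((p.1.part B).toAT (p.1.part_hasOneRoot B)) := by
  have hunique := Graph.Partition.existsUnique_isTrivial hG
  obtain ⟨p, hp⟩ := hunique.exists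
  refine (sum_eq_add_sum_subtype_not hunique hp _).trans (congrArg (· + _) ?_)
  refine congrArg₂ _ ?_ ?_
  · rw [(Graph.Partition.toAF_skeleton_eq_bullet_iff hG).2 hp]
    exact DualAT.toAF_toAF b Graph.bullet_hasOneRoot
  · have := hp.subsingleton_index
    obtain ⟨r, -⟩ := hG.exists
    exact (Fintype.prod_subsingleton _ (p.toIndex r)).trans
      (congrArg x (Subtype.ext (hp.toAF_part _)))

theorem substAT_bulletDual (b : DualAT k) : substAT b (bulletDual k) = b := by
  refine DualAT.ext_toAT fun G hG => ?_
  rw [substAT_toAT, bulletDual_bullet, one_mul, Finset.sum_eq_zero fun p _ => ?_, add_zero]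
  rw [DualAT.toAF_toAF _ (p.1.skeleton_hasOneRoot_iff.2 hG), bulletDual_toAT_of_ne _
    (mt (Graph.Partition.toAF_skeleton_eq_bullet_iff hG).1 p.2), zero_mul]

theorem subst_toAF_bulletDual (b : DualAT k) : subst b (bulletDual k).toAF = b.toAF := by
  rw [← substAT_toAF, substAT_bulletDual]

theorem bulletDual_substAT (b : DualAT k) : substAT (bulletDual k) b = b :=
  DualAT.toAF_injective <| by rw [substAT_toAF, bulletDual_subst]

theorem substAT_assoc (b c d : DualAT k) :
    substAT (substAT d c) b = substAT d (substAT c b) :=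
  DualAT.toAF_injective <| by
    rw [substAT_toAF, substAT_toAF, substAT_toAF, subst_subst]

theorem substAT_bullet (x b : DualAT k) :
    substAT x b AT.bullet = b AT.bullet * x AT.bullet := by
  refine (substAT_toAT x b Graph.bullet_hasOneRoot).trans (add_eq_left.2 ?_)
  refine Finset.sum_eq_zero fun p _ => absurd ?_ p.2
  have : Subsingleton Graph.bullet.V := inferInstanceAs (Subsingleton Unit)
  have : Subsingleton p.1.Index := p.1.toIndex_surjective.subsingleton
  exact Graph.Partition.isTrivial_of_subsingleton_index Graph.bullet_hasOneRoot

theorem isRecursiveInverse_iff {b : DualAT k} (hb : b AT.bullet ≠ 0) (x : DualAT k) :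
    IsRecursiveInverse b x ↔ substAT x b = bulletDual k := by
  have hbullet :
      x AT.bullet = 1 / b AT.bullet ↔ substAT x b AT.bullet = bulletDual k AT.bullet := by
    rw [substAT_bullet, bulletDual_bullet, eq_div_iff hb, mul_comm]
  have htree {G : Graph} (hG : G.HasOneRoot) (S : k) :
      x (G.toAT hG) = -(1 / b AT.bullet) * S ↔ b AT.bullet * x (G.toAT hG) + S = 0 := by
    rw [neg_mul, one_div_mul_eq_div, ← neg_div, eq_div_iff hb, mul_comm, eq_neg_iff_add_eq_zero]
  constructor
  · rintro ⟨hx, hrec⟩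
    refine DualAT.ext_toAT fun G hG => ?_
    by_cases hG' : G.toAT hG = AT.bullet
    · rw [hG']
      exact hbullet.1 hx
    · rw [substAT_toAT, (htree hG _).1 (hrec G hG hG')]
      exact (if_neg hG').symm
  · refine fun h => ⟨hbullet.2 (congrFun h _), fun G hG hG' => (htree hG _).2 ?_⟩
    rw [← substAT_toAT, h]
    exact if_neg hG'

theorem substAT_bijective {b : DualAT k} (hb : b AT.bullet ≠ 0) :
    Function.Bijective fun x => substAT x b := by
  refine bijective_of_triangular (InvImage.wf (fun τ : AT => AF.size τ.1) wellFounded_lt)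
    (fun _ => isUnit_iff_ne_zero.2 hb) fun f g τ hfg => ?_
  obtain ⟨G, hG, rfl⟩ := τ.exists_toAT
  have hpart (p : {p : G.Partition // ¬ p.IsTrivial}) (B : p.1.Index) :
      f ((p.1.part B).toAT (p.1.part_hasOneRoot B)) =
        g ((p.1.part B).toAT (p.1.part_hasOneRoot B)) :=
    hfg _ (Graph.Partition.card_part_lt hG p.2 B)
  simp only [substAT_toAT, hpart, add_sub_add_right_eq_sub, mul_sub]

theorem substAT_eq_bulletDual_symm {b x : DualAT k} (hb : b AT.bullet ≠ 0)
    (h : substAT x b = bulletDual k) : substAT b x = bulletDual k :=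
  (substAT_bijective hb).injective <|
    show substAT (substAT b x) b = substAT (bulletDual k) b by
      rw [substAT_assoc, h, substAT_bulletDual, bulletDual_substAT]

end Substitution

end Aromatic

end

theorem proposition5p4 (k : Type*) [Field k] :
    -- the series indexed by aromatic forests form an algebra under the composition product
    ((∀ a₁ a₂ a₃ : DualAF k, comp (comp a₁ a₂) a₃ = comp a₁ (comp a₂ a₃)) ∧
      (∀ a : DualAF k, comp (counit k) a = a ∧ comp a (counit k) = a) ∧
      (∀ (α₁ α₂ : k) (a₁ a₂ a : DualAF k),
        comp (α₁ • a₁ + α₂ • a₂) a = α₁ • comp a₁ a + α₂ • comp a₂ a ∧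
        comp a (α₁ • a₁ + α₂ • a₂) = α₁ • comp a a₁ + α₂ • comp a a₂) ∧
      (∀ a : DualAF k, (∃ a' : DualAF k, IsCompInverse a a') ↔ a AF.empty ≠ 0)) ∧
    -- (a) the monoid of series indexed by aromatic trees
    ((∀ b c : DualAT k, (substAT c b).toAF = subst c b.toAF) ∧
      (∀ b c d : DualAT k, substAT (substAT d c) b = substAT d (substAT c b)) ∧
      (∀ b : DualAT k, substAT (bulletDual k) b = b ∧ substAT b (bulletDual k) = b)) ∧
    -- (a) its action by algebra morphisms
    ((∀ (b : DualAT k) (α₁ α₂ : k) (a₁ a₂ : DualAF k),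
        subst b (α₁ • a₁ + α₂ • a₂) = α₁ • subst b a₁ + α₂ • subst b a₂) ∧
      (∀ (b c : DualAT k) (a : DualAF k), subst c (subst b a) = subst (substAT c b) a) ∧
      (∀ b : DualAT k, subst b (bulletDual k).toAF = b.toAF) ∧
      (∀ a : DualAF k, subst (bulletDual k) a = a) ∧
      (∀ (b : DualAT k) (a₁ a₂ : DualAF k),
        subst b (comp a₁ a₂) = comp (subst b a₁) (subst b a₂)) ∧
      (∀ b : DualAT k, subst b (counit k) = counit k) ∧
      (∀ (b : DualAT k) (a a' : DualAF k),
        IsCompInverse a a' → IsCompInverse (subst b a) (subst b a'))) ∧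
    -- (b) the group of the series with nonzero coefficient at the single node
    ((∀ b c : DualAT k, b AT.bullet ≠ 0 → c AT.bullet ≠ 0 → substAT c b AT.bullet ≠ 0) ∧
      bulletDual k AT.bullet ≠ 0 ∧
      (∀ b : DualAT k, b AT.bullet ≠ 0 →
        (∃! b' : DualAT k, IsRecursiveInverse b b') ∧
        ∀ b' : DualAT k, IsRecursiveInverse b b' →
          b' AT.bullet ≠ 0 ∧ substAT b b' = bulletDual k ∧ substAT b' b = bulletDual k)) := by
  refine ⟨⟨comp_assoc, fun a => ⟨counit_comp a, comp_counit a⟩, fun α₁ α₂ a₁ a₂ a =>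
      ⟨comp_linear_left α₁ α₂ a₁ a₂ a, comp_linear_right α₁ α₂ a₁ a₂ a⟩, exists_isCompInverse_iff⟩,
    ⟨fun b c => substAT_toAF c b, substAT_assoc,
      fun b => ⟨bulletDual_substAT b, substAT_bulletDual b⟩⟩,
    ⟨subst_linear, fun b c a => subst_subst b c a, subst_toAF_bulletDual, bulletDual_subst,
      subst_comp, subst_counit, fun b _ _ h => h.subst b⟩,
    fun b c hb hc => ?_, ?_, fun b hb => ⟨?_, fun b' h => ?_⟩⟩
  · rw [substAT_bullet]
    exact mul_ne_zero hb hc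
  · rw [bulletDual_bullet]
    exact one_ne_zero
  · simp only [isRecursiveInverse_iff hb]
    exact (substAT_bijective hb).existsUnique _
  · have hleft := (isRecursiveInverse_iff hb b').1 h
    exact ⟨h.1 ▸ one_div_ne_zero hb, substAT_eq_bulletDual_symm hb hleft, hleft⟩
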